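/- Let $X$ be a collectionwise normal Hausdorff space, i.e. for every discrete collection $\mathscr{D}$ of subsets of $X$ there are open sets $U_D\supset D$, $D\in\mathscr{D}$, such that the indexed family $\{U_D:D\in\mathscr{D}\}$ is discrete (a family is discrete if every point of $X$ has a neighbourhood meeting at most one of its members). Let $E$ be a real Hilbert space, and let $\Phi$ assign to every $x\in X$ a nonempty closed convex subset $\Phi(x)$ of $E$. Suppose that $\Phi$ is lower semi-continuous, i.e. $\{x\in X:\Phi(x)\cap U\neq\emptyset\}$ is open in $X$ for every open $U\subset E$. If for some $\varepsilon>0$ there is a continuous map $g:X\to E$ such that every $g(x)$, $x\in X$, lies in the open $\varepsilon$-neighbourhood $\bigcup_{p\in\Phi(x)}\{y\in E:\|y-p\|<\varepsilon\}$ of $\Phi(x)$, then $\Phi$ has a continuous selection, i.e. there is a continuous map $f:X\to E$ such that $f(x)\in\Phi(x)$ for every $x\in X$. -/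

import Mathlib

open Topology

/-- An indexed family of subsets of a space is discrete if every point has a neighbourhood
meeting at most one member of the family. -/
def IsDiscreteFamily {X ι : Type*} [TopologicalSpace X] (D : ι → Set X) : Prop :=
  ∀ x : X, ∃ V ∈ 𝓝 x, {i : ι | (D i ∩ V).Nonempty}.Subsingleton

/-- A space is collectionwise normal if every discrete collection `𝒟` of subsets has an open
discrete expansion: open sets `U D ⊇ D`, for `D ∈ 𝒟`, forming a discrete family. -/
def IsCollectionwiseNormal (X : Type*) [TopologicalSpace X] : Prop :=
  ∀ 𝒟 : Set (Set X), IsDiscreteFamily (fun D : 𝒟 => (D : Set X)) →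
    ∃ U : 𝒟 → Set X, (∀ D, IsOpen (U D)) ∧ IsDiscreteFamily U ∧ ∀ D : 𝒟, (D : Set X) ⊆ U D

/-- The collection of all nonempty closed convex subsets of a real normed space. -/
def closedConvexSets (E : Type*) [NormedAddCommGroup E] [NormedSpace ℝ E] : Set (Set E) :=
  {S | S.Nonempty ∧ IsClosed S ∧ Convex ℝ S}

/-- `f` is a selection for the set-valued mapping `Φ`. -/
def IsSelection {X Y : Type*} (f : X → Y) (Φ : X → Set Y) : Prop :=
  ∀ x, f x ∈ Φ x

/-- `f` is an `ε`-selection for `Φ`: each `f x` lies in the open `ε`-neighbourhood of `Φ x`,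
i.e. in the union of the open `ε`-balls centred at the points of `Φ x`. -/
def IsEpsSelection {X Y : Type*} [PseudoMetricSpace Y] (ε : ℝ) (f : X → Y) (Φ : X → Set Y) :
    Prop :=
  ∀ x, f x ∈ Metric.thickening ε (Φ x)

/-! ### Discrete and locally finite open expansions -/

section CollectionwiseNormal

open Set Filter

variable {X : Type*} [TopologicalSpace X]

/-! It suffices to improve an approximate selection by a fixed factor below 1 while moving it by at
most twice its error (`exists_improved_approx`): iteration converges uniformly, and the limit lies
in the closed values.

After translation and rescaling, the values are convex subsets of the open unit ball and the
approximate selection to be improved is 0. Where 0 cannot serve with the smaller error, the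
parallelogram law forces the value to have small diameter. Such a value is close to a set of vectors
of coordinate `ℓ¹`-norm at most `n`, for some `n`. This splits the problem into countably many
closed pieces, glued by Urysohn functions (`exists_approx_iUnion`).

For fixed `n`, the error is lowered from 1 to 1/2 in finitely many tiny steps
(`exists_approx_of_subset_thickening`). Where a step fails, the parallelogram law makes any
selection of almost nearest points oscillate by at most `θ`. It is then approximated coordinate by
coordinate. By Bessel, boundedly many coordinates are large at any point, so collectionwise
normality provides locally finite open supports and the sum is continuous. Coordinatewise errors of
order `θ` have small `ℓ²`-sum thanks to the `ℓ¹` bound. -/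

/-- Indexed form of collectionwise normality. -/
theorem IsCollectionwiseNormal.exists_expansion (hX : IsCollectionwiseNormal X) {J : Type*}
    {A : J → Set X} (hA : IsDiscreteFamily A) :
    ∃ U : J → Set X, (∀ j, IsOpen (U j)) ∧ IsDiscreteFamily U ∧ ∀ j, A j ⊆ U j := by
  classical
  have hinj : ∀ i j, (A i).Nonempty → A i = A j → i = j := by
    rintro i j ⟨x, hx⟩ hij
    obtain ⟨V, hV, hsub⟩ := hA x
    exact hsub ⟨x, hx, mem_of_mem_nhds hV⟩ ⟨x, hij ▸ hx, mem_of_mem_nhds hV⟩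
  obtain ⟨U, hUo, hUd, hU⟩ := hX (range A) (by
    intro x
    obtain ⟨V, hV, hsub⟩ := hA x
    refine ⟨V, hV, ?_⟩
    rintro ⟨_, i, rfl⟩ hi ⟨_, j, rfl⟩ hj
    have := hsub hi hj
    subst this
    rfl)
  -- Many indices may share the empty set, so their members are made empty; nonempty members
  -- determine their index.
  refine ⟨fun j => {x ∈ U ⟨A j, j, rfl⟩ | (A j).Nonempty}, fun j => (hUo _).inter isOpen_const,
    fun x => ?_, fun j x hx => ⟨hU ⟨A j, j, rfl⟩ hx, x, hx⟩⟩
  obtain ⟨V, hV, hsub⟩ := hUd x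
  refine ⟨V, hV, ?_⟩
  rintro i ⟨y, ⟨hy, hne⟩, hyV⟩ j ⟨z, ⟨hz, -⟩, hzV⟩
  exact hinj i j hne (congrArg Subtype.val
    (hsub (show ⟨A i, i, rfl⟩ ∈ _ from ⟨y, hy, hyV⟩) (show ⟨A j, j, rfl⟩ ∈ _ from ⟨z, hz, hzV⟩)))

theorem IsCollectionwiseNormal.normalSpace (hX : IsCollectionwiseNormal X) : NormalSpace X := by
  refine ⟨fun s t hs ht hst => ?_⟩
  obtain ⟨U, hUo, hUd, hU⟩ := hX.exists_expansion (A := fun b : Bool => if b then s else t) (by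
    intro x
    by_cases hx : x ∈ s
    · refine ⟨tᶜ, ht.isOpen_compl.mem_nhds (disjoint_left.1 hst hx), ?_⟩
      rintro (_ | _) ⟨y, hy, hy'⟩ (_ | _) ⟨z, hz, hz'⟩ <;> simp_all
    · refine ⟨sᶜ, hs.isOpen_compl.mem_nhds hx, ?_⟩
      rintro (_ | _) ⟨y, hy, hy'⟩ (_ | _) ⟨z, hz, hz'⟩ <;> simp_all)
  refine ⟨U true, U false, hUo _, hUo _, by simpa using hU true, by simpa using hU false,
    disjoint_left.2 fun x hx hx' => ?_⟩
  obtain ⟨V, hV, hsub⟩ := hUd x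
  exact absurd (hsub ⟨x, hx, mem_of_mem_nhds hV⟩ ⟨x, hx', mem_of_mem_nhds hV⟩) (by simp)

/-- In a collectionwise normal space, a locally finite family of closed sets of finite order
has a locally finite open expansion. -/
theorem IsCollectionwiseNormal.exists_locallyFinite_expansion (hX : IsCollectionwiseNormal X)
    {J : Type*} (N : ℕ) {A : J → Set X} (hAc : ∀ j, IsClosed (A j)) (hA : LocallyFinite A)
    (hN : ∀ x, ∀ s : Finset J, (∀ j ∈ s, x ∈ A j) → s.card ≤ N) :
    ∃ G : J → Set X, (∀ j, IsOpen (G j)) ∧ LocallyFinite G ∧ ∀ j, A j ⊆ G j := by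
  classical
  induction N generalizing A with
  | zero =>
    refine ⟨fun _ => ∅, fun _ => isOpen_empty, fun x => ⟨univ, univ_mem, by simp⟩,
      fun j x hx => ?_⟩
    have := hN x {j} (by simpa using hx)
    simp at this
  | succ N ih =>
    -- The maximal, `(N + 1)`-fold, intersections form a discrete family: near `x` only index sets
    -- `s` with `x ∈ A j` for all `j ∈ s` matter, and two different ones would put `x` in more than
    -- `N + 1` sets.
    let S := {s : Finset J // s.card = N + 1}
    obtain ⟨U₀, hUo₀, hUd₀, hU₀⟩ := hX.exists_expansion
      (A := fun s : S => {x | ∀ j ∈ s.1, x ∈ A j}) (by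
        intro x
        obtain ⟨V, hV, hfin⟩ := hA x
        refine ⟨V ∩ ⋂ j ∈ {j | (A j ∩ V).Nonempty} ∩ {j | x ∉ A j}, (A j)ᶜ,
          inter_mem hV ((biInter_mem (hfin.subset inter_subset_left)).2
            fun j hj => (hAc j).isOpen_compl.mem_nhds hj.2), ?_⟩
        have key : ∀ s : S, ({x | ∀ j ∈ s.1, x ∈ A j} ∩ (V ∩ ⋂ j ∈ {j | (A j ∩ V).Nonempty} ∩
            {j | x ∉ A j}, (A j)ᶜ)).Nonempty → ∀ j ∈ s.1, x ∈ A j := by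
          rintro s ⟨y, hy, hyV, hy'⟩ j hj
          by_contra hxj
          exact mem_iInter₂.1 hy' j ⟨⟨y, hy j hj, hyV⟩, hxj⟩ (hy j hj)
        intro s hs t ht
        have hst := hN x (s.1 ∪ t.1) fun j hj => (Finset.mem_union.1 hj).elim
          (key s hs j) (key t ht j)
        have h1 := Finset.eq_of_subset_of_card_le (Finset.subset_union_left (s₂ := t.1))
          (hst.trans s.2.ge)
        have h2 := Finset.eq_of_subset_of_card_le (Finset.subset_union_right (s₁ := s.1))
          (hst.trans t.2.ge)
        exact Subtype.ext (h1.trans h2.symm))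
    -- Deleting the `A j` with `j ∉ s` ensures that `U s` meets only those `A j` with `j ∈ s`. Off
    -- the union of the `U s` the order drops to `N`.
    let U : S → Set X := fun s => U₀ s ∩ (⋃ j : {j // j ∉ s.1}, A j)ᶜ
    have hUo : ∀ s, IsOpen (U s) := fun s => (hUo₀ s).inter
      ((hA.comp_injective Subtype.coe_injective).isClosed_iUnion fun j => hAc _).isOpen_compl
    have hUd : IsDiscreteFamily U := fun x => by
      obtain ⟨V, hV, hsub⟩ := hUd₀ x
      exact ⟨V, hV, hsub.anti fun s hs => hs.mono (inter_subset_inter_left _ inter_subset_left)⟩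
    have hU : ∀ s : S, {x | ∀ j ∈ s.1, x ∈ A j} ⊆ U s := by
      refine fun s x hx => ⟨hU₀ s hx, fun hx' => ?_⟩
      obtain ⟨⟨j, hj⟩, hxj⟩ := mem_iUnion.1 hx'
      have := hN x (insert j s.1) (by
        intro i hi
        rcases Finset.mem_insert.1 hi with rfl | hi
        exacts [hxj, hx i hi])
      rw [Finset.card_insert_of_notMem hj, s.2] at this
      omega
    obtain ⟨H, hHo, hHf, hH⟩ := ih (A := fun j => A j ∩ (⋃ s, U s)ᶜ)
      (fun j => (hAc j).inter (isOpen_iUnion hUo).isClosed_compl)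
      (hA.subset fun j => inter_subset_left) (by
        intro x s hs
        by_contra! hlt
        obtain ⟨t, hts, ht⟩ := Finset.exists_subset_card_eq (Nat.succ_le_of_lt hlt)
        obtain ⟨j, hj⟩ : t.Nonempty := Finset.card_pos.1 (by omega)
        refine (hs j (hts hj)).2 (mem_iUnion.2 ⟨⟨t, ht⟩, hU ⟨t, ht⟩ fun i hi => ?_⟩)
        exact (hs i (hts hi)).1)
    refine ⟨fun j => H j ∪ ⋃ s : {s : S // j ∈ s.1}, U s.1,
      fun j => (hHo j).union (isOpen_iUnion fun s => hUo _), fun x => ?_, fun j x hx => ?_⟩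
    · obtain ⟨V, hV, hVf⟩ := hHf x
      obtain ⟨W, hW, hWs⟩ := hUd x
      refine ⟨V ∩ W, inter_mem hV hW, ?_⟩
      have hfin : (⋃ s ∈ {s : S | (U s ∩ W).Nonempty}, (s.1 : Set J)).Finite :=
        hWs.finite.biUnion fun s _ => s.1.finite_toSet
      refine (hVf.union hfin).subset ?_
      rintro j ⟨y, hy | hy, hyV, hyW⟩
      · exact Or.inl ⟨y, hy, hyV⟩
      · obtain ⟨s, hs⟩ := mem_iUnion.1 hy
        exact Or.inr (mem_biUnion (show s.1 ∈ _ from ⟨y, hs, hyW⟩) s.2)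
    · by_cases hxU : x ∈ ⋃ s, U s
      · obtain ⟨s, hs⟩ := mem_iUnion.1 hxU
        have hj : j ∈ s.1 := by
          by_contra hj
          exact hs.2 (mem_iUnion.2 ⟨⟨j, hj⟩, hx⟩)
        exact Or.inr (mem_iUnion.2 ⟨⟨s, hj⟩, hs⟩)
      · exact Or.inl (hH j ⟨hx, hxU⟩)

end CollectionwiseNormal

/-! ### Continuous approximation of real functions of small oscillation -/

section Oscillation

open Set Filter

variable {X : Type*} [TopologicalSpace X]

/-- `p` has oscillation at most `θ` along `F`. -/
def OscLE {M : Type*} [NormedAddCommGroup M] (θ : ℝ) (p : X → M) (F : Set X) : Prop :=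
  ∀ x ∈ F, ∀ᶠ x' in 𝓝 x, x' ∈ F → ‖p x' - p x‖ ≤ θ

/-- A limit point `x` stays in `F`, and points of the set arbitrarily near `x` have `q`-value at
most `q x + θ`. -/
theorem OscLE.closure_subset {θ : ℝ} {q : X → ℝ} {F : Set X} (hF : IsClosed F)
    (hq : OscLE θ q F) (a : ℝ) : closure {x ∈ F | a ≤ q x} ⊆ {x ∈ F | a - θ ≤ q x} := by
  intro x hx
  have hxF : x ∈ F := closure_minimal (fun y hy => hy.1) hF hx
  obtain ⟨y, hy, hyF, hya⟩ := ((mem_closure_iff_frequently.1 hx).and_eventually (hq x hxF)).exists.imp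
    fun y hy => (⟨hy.2, hy.1.1, hy.1.2⟩ : _ ∧ _ ∧ _)
  have := (abs_le.1 (hy hyF)).2
  exact ⟨hxF, by linarith⟩

theorem OscLE.neg {θ : ℝ} {q : X → ℝ} {F : Set X} (hq : OscLE θ q F) : OscLE θ (-q) F :=
  fun x hx => (hq x hx).mono fun y hy hyF => by
    have := hy hyF
    rw [Real.norm_eq_abs] at this ⊢
    rw [abs_sub_comm] at this
    convert this using 2
    simp only [Pi.neg_apply]
    ring

/-- Approximation from below of a real function of small oscillation on a closed set. -/
theorem OscLE.exists_continuous_approx_pos [NormalSpace X] {θ : ℝ} (hθ : 0 < θ) {q : X → ℝ}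
    {F G : Set X} (hF : IsClosed F) (hq : OscLE θ q F) (hG : IsOpen G)
    (hFG : closure {x ∈ F | 4 * θ ≤ q x} ⊆ G) {M : ℝ} (hM : ∀ x ∈ F, q x ≤ M) :
    ∃ f : X → ℝ, Continuous f ∧ (∀ x, x ∉ G → f x = 0) ∧ (∀ x, 0 ≤ f x) ∧
      ∀ x ∈ F, f x ≤ max (q x) 0 ∧ q x - 8 * θ ≤ f x := by
  -- `f` is a staircase of `K` Urysohn functions of height `4 * θ`, each rising one level later than
  -- `q`, so that `f` stays below the positive part of `q`.
  have key : ∀ K : ℕ, ∃ f : X → ℝ, Continuous f ∧ (∀ x, x ∉ G → f x = 0) ∧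
      (∀ x, 0 ≤ f x ∧ f x ≤ K * (4 * θ)) ∧ ∀ x ∈ F, f x ≤ max (q x) 0 ∧
        ((K + 1) * (4 * θ) ≤ q x → K * (4 * θ) ≤ f x) ∧
        (q x ≤ (K + 1) * (4 * θ) → q x - 8 * θ ≤ f x) := by
    intro K
    induction K with
    | zero => exact ⟨fun _ => 0, continuous_const, by simp, by simp, by
        intro x _
        refine ⟨by simp, by simp, fun h => ?_⟩
        push_cast at h
        linarith⟩
    | succ K ih =>
      obtain ⟨f, hfc, hfG, hf0, hf⟩ := ih
      let B : Set X := closure {x ∈ F | -((K + 1) * (4 * θ)) ≤ (-q) x}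
      let A : Set X := closure {x ∈ F | (K + 2) * (4 * θ) ≤ q x}
      -- The levels defining `A` and `B` differ by `4 * θ`; taking closures costs only `θ` on each
      -- side.
      have hd : Disjoint (Gᶜ ∪ B) A := by
        refine disjoint_left.2 fun x hx hxA => ?_
        have hA := hq.closure_subset hF _ hxA
        rcases hx with hx | hx
        · refine hx (hFG (closure_mono ?_ hxA))
          rintro y ⟨hyF, hy⟩
          refine ⟨hyF, le_trans ?_ hy⟩
          nlinarith [K.cast_nonneg (α := ℝ)]
        · have hB := hq.neg.closure_subset hF _ hx
          have h1 := hA.2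
          have h2 := hB.2
          simp only [Pi.neg_apply] at h2
          nlinarith
      obtain ⟨u, hu0, hu1, hu⟩ := exists_continuous_zero_one_of_isClosed
        (hG.isClosed_compl.union isClosed_closure) isClosed_closure hd
      refine ⟨fun x => f x + 4 * θ * u x, by fun_prop, fun x hx => ?_, fun x => ?_,
        fun x hx => ?_⟩
      · simp [hfG x hx, hu0 (Or.inl hx : x ∈ Gᶜ ∪ B)]
      · have := hf0 x
        have := hu x
        push_cast
        constructor
        · nlinarith [(hf0 x).1, (hu x).1]
        · nlinarith [(hf0 x).2, (hu x).2]
      · obtain ⟨h1, h2, h3⟩ := hf x hx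
        have h01 := hu x
        have h02 := hf0 x
        push_cast
        refine ⟨?_, fun h => ?_, fun h => ?_⟩
        · by_cases hle : q x ≤ (K + 1) * (4 * θ)
          · have hxB : x ∈ B := subset_closure ⟨hx, by simpa using hle⟩
            have : u x = 0 := hu0 (Or.inr hxB)
            simpa [this] using h1
          · refine le_max_of_le_left ?_
            nlinarith [h01.2, h02.2]
        · have hxA : x ∈ A := subset_closure ⟨hx, by linarith⟩
          have : u x = 1 := hu1 hxA
          have := h2 (by nlinarith)
          nlinarith
        · have h4 : 0 ≤ 4 * θ * u x := mul_nonneg (by positivity) h01.1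
          by_cases hle : q x ≤ (K + 1) * (4 * θ)
          · linarith [h3 hle]
          · have := h2 (by linarith)
            nlinarith
  obtain ⟨K, hK⟩ := exists_nat_ge (M / (4 * θ))
  obtain ⟨f, hfc, hfG, hf0, hf⟩ := key K
  refine ⟨f, hfc, hfG, fun x => (hf0 x).1, fun x hx => ⟨(hf x hx).1, (hf x hx).2.2 ?_⟩⟩
  rw [div_le_iff₀ (by positivity)] at hK
  nlinarith [hM x hx]

/-- Approximation of a real function of small oscillation on a closed set. -/
theorem OscLE.exists_continuous_approx [NormalSpace X] {θ : ℝ} (hθ : 0 < θ) {q : X → ℝ}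
    {F G : Set X} (hF : IsClosed F) (hq : OscLE θ q F) (hG : IsOpen G)
    (hFG : closure {x ∈ F | 4 * θ ≤ |q x|} ⊆ G) {M : ℝ} (hM : ∀ x ∈ F, |q x| ≤ M) :
    ∃ f : X → ℝ, Continuous f ∧ (∀ x, x ∉ G → f x = 0) ∧
      ∀ x ∈ F, |f x - q x| ≤ |q x| ∧ |f x - q x| ≤ 8 * θ := by
  obtain ⟨f, hfc, hfG, hf0, hf⟩ := hq.exists_continuous_approx_pos hθ hF hG
    (Subset.trans (closure_mono fun x hx => And.imp_right (fun h => h.trans (le_abs_self _)) hx) hFG)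
    (fun x hx => (le_abs_self _).trans (hM x hx))
  obtain ⟨g, hgc, hgG, hg0, hg⟩ := hq.neg.exists_continuous_approx_pos hθ hF hG
    (Subset.trans (closure_mono fun x hx => And.imp_right (fun h => h.trans (neg_le_abs _)) hx) hFG)
    (fun x hx => (neg_le_abs _).trans (hM x hx))
  refine ⟨fun x => f x - g x, hfc.sub hgc, fun x hx => by simp [hfG x hx, hgG x hx],
    fun x hx => ?_⟩
  obtain ⟨h1, h2⟩ := hf x hx
  obtain ⟨h3, h4⟩ := hg x hx
  have h5 := hf0 x
  have h6 := hg0 x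
  simp only [Pi.neg_apply] at h3 h4
  rcases le_total 0 (q x) with h | h
  · rw [max_eq_left h] at h1
    rw [max_eq_right (by linarith)] at h3
    rw [abs_of_nonneg h, abs_of_nonpos (by linarith)]
    constructor <;> linarith
  · rw [max_eq_right h] at h1
    rw [max_eq_left (by linarith)] at h3
    rw [abs_of_nonpos h, abs_of_nonneg (by linarith)]
    constructor <;> linarith

end Oscillation

/-! ### Coordinatewise approximation in a Hilbert space -/

section Hilbert

open Set Filter

variable {X E : Type*} [TopologicalSpace X] [NormedAddCommGroup E] [InnerProductSpace ℝ E]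
  {ι : Type*}

/-- The vectors whose coordinates with respect to `b` have `ℓ¹`-norm at most `n`. -/
def l1Ball (b : HilbertBasis ι ℝ E) (n : ℝ) : Set E :=
  {y | ∀ s : Finset ι, ∑ i ∈ s, |inner ℝ (b i) y| ≤ n}

theorem l1Ball_mono (b : HilbertBasis ι ℝ E) {m n : ℝ} (h : m ≤ n) : l1Ball b m ⊆ l1Ball b n :=
  fun _ hy s => (hy s).trans h

theorem convex_l1Ball (b : HilbertBasis ι ℝ E) (n : ℝ) : Convex ℝ (l1Ball b n) := by
  intro x hx y hy r t hr ht hrt s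
  calc ∑ i ∈ s, |inner ℝ (b i) (r • x + t • y)|
      ≤ ∑ i ∈ s, (r * |inner ℝ (b i) x| + t * |inner ℝ (b i) y|) := by
        refine Finset.sum_le_sum fun i _ => ?_
        rw [inner_add_right, inner_smul_right, inner_smul_right]
        refine (abs_add_le _ _).trans ?_
        rw [abs_mul, abs_mul, abs_of_nonneg hr, abs_of_nonneg ht]
    _ = r * ∑ i ∈ s, |inner ℝ (b i) x| + t * ∑ i ∈ s, |inner ℝ (b i) y| := by
        rw [Finset.sum_add_distrib, Finset.mul_sum, Finset.mul_sum]
    _ ≤ r * n + t * n := by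
        gcongr
        exacts [hx s, hy s]
    _ = n := by rw [← add_mul, hrt, one_mul]

/-- Finite partial sums of the basis expansion have finite `ℓ¹`-norm and converge to `y`. -/
theorem exists_nat_mem_thickening_l1Ball (b : HilbertBasis ι ℝ E) (y : E) {ε : ℝ} (hε : 0 < ε) :
    ∃ n : ℕ, y ∈ Metric.thickening ε (l1Ball b n) := by
  classical
  obtain ⟨s, hs⟩ := ((b.hasSum_repr y).eventually (Metric.ball_mem_nhds y hε)).exists
  set z := ∑ i ∈ s, b.repr y i • b i with hz
  obtain ⟨n, hn⟩ := exists_nat_ge (∑ i ∈ s, |b.repr y i|)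
  refine ⟨n, Metric.mem_thickening_iff.2 ⟨z, fun t => ?_, by rw [dist_comm]; exact hs⟩⟩
  refine le_trans ?_ hn
  have hc : ∀ i, inner ℝ (b i) z = if i ∈ s then b.repr y i else 0 := by
    intro i
    simp [hz, inner_sum, inner_smul_right, orthonormal_iff_ite.1 b.orthonormal]
  calc ∑ i ∈ t, |inner ℝ (b i) z| = ∑ i ∈ t with i ∈ s, |b.repr y i| := by
        rw [Finset.sum_filter]
        refine Finset.sum_congr rfl fun i _ => ?_
        rw [hc]
        split_ifs <;> simp
    _ ≤ ∑ i ∈ s, |b.repr y i| :=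
        Finset.sum_le_sum_of_subset_of_nonneg (fun i hi => (Finset.mem_filter.1 hi).2)
          fun _ _ _ => abs_nonneg _

theorem HilbertBasis.norm_sq_le (b : HilbertBasis ι ℝ E) {w : E} {M : ℝ}
    (h : ∀ s : Finset ι, ∑ i ∈ s, inner ℝ (b i) w ^ 2 ≤ M) : ‖w‖ ^ 2 ≤ M := by
  have := b.hasSum_inner_mul_inner w w
  rw [real_inner_self_eq_norm_sq] at this
  refine le_of_tendsto this (Eventually.of_forall fun s => ?_)
  refine le_trans (le_of_eq (Finset.sum_congr rfl fun i _ => ?_)) (h s)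
  simp only [sq, real_inner_comm (b i) w]

theorem HilbertBasis.sum_sq_le (b : HilbertBasis ι ℝ E) (w : E) (s : Finset ι) :
    ∑ i ∈ s, inner ℝ (b i) w ^ 2 ≤ ‖w‖ ^ 2 := by
  simpa using b.orthonormal.sum_inner_products_le w (s := s)

/-- A vector with small coordinates, dominated by those of a vector close to an `ℓ¹`-ball,
has small norm. -/
theorem HilbertBasis.norm_sq_le_of_mem_thickening (b : HilbertBasis ι ℝ E) {w y : E}
    {β n τ : ℝ} (hτ : 0 ≤ τ) (hy : y ∈ Metric.thickening β (l1Ball b n))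
    (hwy : ∀ i, |inner ℝ (b i) w| ≤ |inner ℝ (b i) y|) (hw : ∀ i, |inner ℝ (b i) w| ≤ τ) :
    ‖w‖ ^ 2 ≤ 4 * β ^ 2 + 2 * τ * n := by
  obtain ⟨a, ha, hya⟩ := Metric.mem_thickening_iff.1 hy
  refine b.norm_sq_le fun s => ?_
  have hterm : ∀ i, inner ℝ (b i) w ^ 2 ≤
      4 * inner ℝ (b i) (y - a) ^ 2 + 2 * τ * |inner ℝ (b i) a| := by
    intro i
    rw [← sq_abs, ← sq_abs (inner ℝ (b i) (y - a))]
    have h1 : |inner ℝ (b i) w| ≤ |inner ℝ (b i) (y - a)| + |inner ℝ (b i) a| := by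
      refine (hwy i).trans ?_
      rw [inner_sub_right]
      simpa using abs_add_le (inner ℝ (b i) y - inner ℝ (b i) a) (inner ℝ (b i) a)
    have h2 := hw i
    have hW := abs_nonneg (inner ℝ (b i) w)
    generalize |inner ℝ (b i) w| = W at *
    have h3 := abs_nonneg (inner ℝ (b i) (y - a))
    have h4 := abs_nonneg (inner ℝ (b i) a)
    generalize |inner ℝ (b i) (y - a)| = B at *
    generalize |inner ℝ (b i) a| = A at *
    -- The larger of `A` and `B` controls `W`: either `W ≤ 2 * B`, or one factor of `W * W` is
    -- bounded by `2 * A` and the other by `τ`.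
    rcases le_total A B with h | h
    · have : W ≤ 2 * B := by linarith
      have : 0 ≤ 2 * τ * A := by positivity
      nlinarith
    · have h5 : W ≤ 2 * A := by linarith
      have : W * W ≤ τ * (2 * A) := mul_le_mul h2 h5 hW hτ
      nlinarith
  calc ∑ i ∈ s, inner ℝ (b i) w ^ 2
      ≤ ∑ i ∈ s, (4 * inner ℝ (b i) (y - a) ^ 2 + 2 * τ * |inner ℝ (b i) a|) :=
        Finset.sum_le_sum fun i _ => hterm i
    _ = 4 * ∑ i ∈ s, inner ℝ (b i) (y - a) ^ 2 + 2 * τ * ∑ i ∈ s, |inner ℝ (b i) a| := by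
        rw [Finset.sum_add_distrib, Finset.mul_sum, Finset.mul_sum]
    _ ≤ 4 * β ^ 2 + 2 * τ * n := by
        have h1 : ‖y - a‖ ^ 2 ≤ β ^ 2 := by
          rw [← dist_eq_norm]
          exact pow_le_pow_left₀ dist_nonneg hya.le 2
        have h2 := b.sum_sq_le (y - a) s
        have h3 := mul_le_mul_of_nonneg_left (ha s) (show 0 ≤ 2 * τ by positivity)
        linarith

/-- A map of small oscillation on a closed subset of a collectionwise normal space, with values
close to an `ℓ¹`-ball, is approximated on this subset by a continuous map. -/
theorem IsCollectionwiseNormal.exists_continuous_approx (hX : IsCollectionwiseNormal X)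
    (b : HilbertBasis ι ℝ E) {F : Set X} (hF : IsClosed F) {p : X → E} {θ β n : ℝ} (hθ : 0 < θ)
    (hosc : OscLE θ p F) (hp1 : ∀ x ∈ F, ‖p x‖ ≤ 1)
    (hp : ∀ x ∈ F, p x ∈ Metric.thickening β (l1Ball b n)) :
    ∃ v : X → E, Continuous v ∧ ∀ x ∈ F, ‖v x - p x‖ ^ 2 ≤ 4 * β ^ 2 + 16 * θ * n := by
  classical
  have := hX.normalSpace
  have hone : ∀ (i : ι) (w : E), |inner ℝ (b i) w| ≤ ‖w‖ := fun i w => by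
    simpa [b.orthonormal.1 i] using abs_real_inner_le_norm (b i) w
  have hqosc : ∀ i, OscLE θ (fun x => inner ℝ (b i) (p x)) F := fun i x hx =>
    (hosc x hx).mono fun y hy hyF => by
      rw [← inner_sub_right]
      exact (hone i _).trans (hy hyF)
  have hfin : ∀ x ∈ F, ∀ s : Finset ι, (∀ i ∈ s, θ ≤ |inner ℝ (b i) (p x)|) →
      s.card ≤ ⌊1 / θ ^ 2⌋₊ := by
    intro x hx s hs
    refine Nat.le_floor ?_
    rw [le_div_iff₀ (by positivity), ← nsmul_eq_mul]
    calc s.card • θ ^ 2 ≤ ∑ i ∈ s, inner ℝ (b i) (p x) ^ 2 := by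
          refine Finset.card_nsmul_le_sum _ _ _ fun i hi => ?_
          rw [← sq_abs (inner ℝ (b i) (p x))]
          exact pow_le_pow_left₀ hθ.le (hs i hi) 2
      _ ≤ ‖p x‖ ^ 2 := b.sum_sq_le _ _
      _ ≤ 1 := pow_le_one₀ (norm_nonneg _) (hp1 x hx)
  let A : ι → Set X := fun i => closure {x ∈ F | 4 * θ ≤ |inner ℝ (b i) (p x)|}
  have hAsub : ∀ i, A i ⊆ {x ∈ F | 3 * θ ≤ |inner ℝ (b i) (p x)|} := by
    intro i x hx
    have habs : OscLE θ (fun x => |inner ℝ (b i) (p x)|) F := fun x hx =>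
      (hqosc i x hx).mono fun y hy hyF => (abs_abs_sub_abs_le_abs_sub _ _).trans (hy hyF)
    have := habs.closure_subset hF _ hx
    exact ⟨this.1, by linarith [this.2]⟩
  have hAlf : LocallyFinite A := by
    intro x
    by_cases hx : x ∈ F
    · refine ⟨{y | y ∈ F → ‖p y - p x‖ ≤ θ}, hosc x hx, ?_⟩
      by_contra hinf
      -- Every `i` whose `A i` meets this neighbourhood has a coordinate of size at least `3 * θ -
      -- θ` at `x`, so Bessel bounds their number.
      obtain ⟨s, hs, hcard⟩ := Set.Infinite.exists_subset_card_eq hinf (⌊1 / θ ^ 2⌋₊ + 1)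
      have := hfin x hx s fun i hi => by
        obtain ⟨y, hyA, hy⟩ := hs hi
        obtain ⟨hyF, hy3⟩ := hAsub i hyA
        have h1 := (hone i (p y - p x)).trans (hy hyF)
        rw [inner_sub_right] at h1
        have h2 := abs_sub_abs_le_abs_sub (inner ℝ (b i) (p y)) (inner ℝ (b i) (p x))
        linarith
      omega
    · refine ⟨Fᶜ, hF.isOpen_compl.mem_nhds hx, ?_⟩
      convert Set.finite_empty
      refine eq_empty_of_forall_notMem ?_
      rintro i ⟨y, hyA, hy⟩
      exact hy (hAsub i hyA).1
  obtain ⟨G, hGo, hGlf, hAG⟩ := hX.exists_locallyFinite_expansion ⌊1 / θ ^ 2⌋₊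
    (fun i => isClosed_closure) hAlf (fun x s hs => by
      rcases s.eq_empty_or_nonempty with rfl | ⟨i, hi⟩
      · simp
      · exact hfin x (hAsub i (hs i hi)).1 s fun j hj => by
          linarith [(hAsub j (hs j hj)).2])
  choose f hfc hfG hf using fun i => (hqosc i).exists_continuous_approx hθ hF (hGo i) (hAG i)
    (fun x hx => (hone i _).trans (hp1 x hx))
  have hsupp : ∀ i, (Function.support fun x => f i x • b i) ⊆ G i := fun i x hx => by
    by_contra hxG
    exact hx (by simp [hfG i x hxG])
  refine ⟨fun x => ∑ᶠ i, f i x • b i, continuous_finsum (fun i => by have := hfc i; fun_prop)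
    (hGlf.subset hsupp), fun x hx => ?_⟩
  have hcoord : ∀ i, inner ℝ (b i) (∑ᶠ j, f j x • b j) = f i x := by
    intro i
    have hfs : (Function.support fun j => f j x • b j).Finite :=
      (hGlf.point_finite x).subset fun j hj => hsupp j hj
    rw [finsum_eq_sum _ hfs, inner_sum]
    simp only [inner_smul_right, orthonormal_iff_ite.1 b.orthonormal, mul_ite, mul_one, mul_zero,
      Finset.sum_ite_eq, Finite.mem_toFinset, Function.mem_support, ne_eq, smul_eq_zero]
    split_ifs with h
    · exact (h.resolve_right (b.orthonormal.ne_zero i)).symm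
    · rfl
  have := b.norm_sq_le_of_mem_thickening (w := (∑ᶠ i, f i x • b i) - p x) (τ := 8 * θ)
    (by positivity) (hp x hx)
    (fun i => by rw [inner_sub_right, hcoord]; exact (hf i x hx).1)
    (fun i => by rw [inner_sub_right, hcoord]; exact (hf i x hx).2)
  linarith

end Hilbert

/-! ### Gluing, almost nearest points, and values near a fixed `ℓ¹`-ball -/

section Selection

open Set Filter

variable {X E : Type*} [TopologicalSpace X] [NormedAddCommGroup E]

/-- Lower semicontinuity with a test set that varies with `x`, as needed for balls centred at `g x`.
-/
theorem LowerHemicontinuous.isOpen_setOf_exists_mem {Y : Type*} [TopologicalSpace Y]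
    {Φ : X → Set Y} (hΦ : LowerHemicontinuous Φ) {O : Set (X × Y)} (hO : IsOpen O) :
    IsOpen {x | ∃ y ∈ Φ x, (x, y) ∈ O} := by
  rw [isOpen_iff_mem_nhds]
  rintro x ⟨y, hy, hxy⟩
  obtain ⟨U, V, hU, hV, hxU, hyV, hUV⟩ := isOpen_prod_iff.1 hO x y hxy
  filter_upwards [lowerHemicontinuousAt_iff.1 (hΦ x) V hV ⟨y, hy, hyV⟩, hU.mem_nhds hxU]
    with x' ⟨y', hy', hyV'⟩ hx'
  exact ⟨y', hy', hUV ⟨hx', hyV'⟩⟩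

theorem LowerHemicontinuous.inter_isOpen {Y : Type*} [TopologicalSpace Y]
    {Φ : X → Set Y} (hΦ : LowerHemicontinuous Φ) {W : Set Y} (hW : IsOpen W) :
    LowerHemicontinuous fun x => Φ x ∩ W := by
  rw [lowerHemicontinuous_iff_isOpen_inter_nonempty] at hΦ ⊢
  intro U hU
  simpa only [inter_assoc] using hΦ (W ∩ U) (hW.inter hU)

theorem LowerHemicontinuous.isOpen_setOf_mem_thickening {Φ : X → Set E}
    (hΦ : LowerHemicontinuous Φ) {g : X → E} (hg : Continuous g) (r : ℝ) :
    IsOpen {x | g x ∈ Metric.thickening r (Φ x)} := by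
  have := hΦ.isOpen_setOf_exists_mem (O := {z : X × E | dist (g z.1) z.2 < r})
    (isOpen_lt (by fun_prop) continuous_const)
  simp only [Metric.mem_thickening_iff]
  exact this

variable [InnerProductSpace ℝ E]

/-- Glueing two maps along disjoint closed sets preserves being near a convex-valued mapping. -/
theorem exists_continuous_glue [NormalSpace X] {Φ : X → Set E} (hΦ : ∀ x, Convex ℝ (Φ x))
    {g v : X → E} (hg : Continuous g) (hv : Continuous v) {A B : Set X} (hA : IsClosed A)
    (hB : IsClosed B) (hAB : Disjoint A B) (r : ℝ) :
    ∃ h : X → E, Continuous h ∧ EqOn h g A ∧ ∀ x, (x ∉ B → g x ∈ Metric.thickening r (Φ x)) →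
      (x ∉ A → v x ∈ Metric.thickening r (Φ x)) → h x ∈ Metric.thickening r (Φ x) := by
  obtain ⟨u, hu0, hu1, hu⟩ := exists_continuous_zero_one_of_isClosed hA hB hAB
  have h0 : ∀ x ∈ A, (1 - u x) • g x + u x • v x = g x := fun x hx => by simp [hu0 hx]
  have h1 : ∀ x ∈ B, (1 - u x) • g x + u x • v x = v x := fun x hx => by simp [hu1 hx]
  refine ⟨fun x => (1 - u x) • g x + u x • v x, by fun_prop, h0, fun x hgx hvx => ?_⟩
  by_cases hxA : x ∈ A
  · simpa only [h0 x hxA] using hgx (disjoint_left.1 hAB hxA)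
  by_cases hxB : x ∈ B
  · simpa only [h1 x hxB] using hvx hxA
  exact (hΦ x).thickening r (hgx hxB) (hvx hxA) (sub_nonneg.2 (hu x).2) (hu x).1 (by ring)

/-- Points of a convex set that nearly realise the distance to `a` are close to each other. -/
theorem Convex.dist_sq_le_of_notMem_thickening {S : Set E} (hS : Convex ℝ S) {a y z : E}
    {r r' : ℝ} (hr' : 0 ≤ r') (hy : y ∈ S) (hz : z ∈ S) (hay : dist a y < r) (haz : dist a z < r)
    (ha : a ∉ Metric.thickening r' S) : dist y z ^ 2 ≤ 4 * r ^ 2 - 4 * r' ^ 2 := by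
  have hm : r' ≤ dist a (midpoint ℝ y z) := by
    by_contra! h
    exact ha (Metric.mem_thickening_iff.2 ⟨_, hS.midpoint_mem hy hz, h⟩)
  have hp := parallelogram_law_with_norm ℝ (a - y) (a - z)
  have h1 : (a - y) + (a - z) = (2 : ℝ) • (a - midpoint ℝ y z) := by
    rw [midpoint_eq_smul_add, smul_sub, smul_smul]
    norm_num
    rw [two_smul]
    abel
  have h2 : (a - y) - (a - z) = z - y := by abel
  rw [h1, h2, norm_smul, ← dist_eq_norm, ← dist_eq_norm, ← dist_eq_norm, ← dist_eq_norm,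
    dist_comm z y, Real.norm_eq_abs, abs_of_nonneg (by norm_num : (0 : ℝ) ≤ 2)] at hp
  have h3 := mul_self_le_mul_self hr' hm
  have h4 := mul_self_le_mul_self dist_nonneg hay.le
  have h5 := mul_self_le_mul_self dist_nonneg haz.le
  nlinarith

theorem Convex.dist_le_of_notMem_thickening {S : Set E} (hS : Convex ℝ S) {a y z : E}
    {r r' : ℝ} (hr' : 0 ≤ r') (hy : y ∈ S) (hz : z ∈ S) (hay : dist a y < r) (haz : dist a z < r)
    (ha : a ∉ Metric.thickening r' S) : dist y z ≤ √(4 * r ^ 2 - 4 * r' ^ 2) :=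
  Real.le_sqrt_of_sq_le (hS.dist_sq_le_of_notMem_thickening hr' hy hz hay haz ha)

/-- Lower semicontinuity provides `y ∈ Ψ x'` near `p x` and within `r` of `g x'`. Both `y` and `p
x'` are almost nearest to `g x'`, hence close to each other; `p` itself may be arbitrary. -/
theorem LowerHemicontinuous.oscLE {Ψ : X → Set E} (hΨ : LowerHemicontinuous Ψ)
    (hconv : ∀ x, Convex ℝ (Ψ x)) {g p : X → E} (hg : Continuous g) {r r' θ : ℝ} (hθ : 0 < θ)
    (hr' : 0 ≤ r') (hrr' : 4 * r ^ 2 - 4 * r' ^ 2 < θ ^ 2) {F : Set X}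
    (hF : ∀ x ∈ F, g x ∉ Metric.thickening r' (Ψ x)) (hp : ∀ x ∈ F, p x ∈ Ψ x)
    (hgp : ∀ x ∈ F, dist (g x) (p x) < r) : OscLE θ p F := by
  intro x hx
  have hs : √(4 * r ^ 2 - 4 * r' ^ 2) < θ := (Real.sqrt_lt' hθ).2 hrr'
  have hmem : {x' | g x' ∈ Metric.thickening r
      (Ψ x' ∩ Metric.ball (p x) (θ - √(4 * r ^ 2 - 4 * r' ^ 2)))} ∈ 𝓝 x :=
    ((hΨ.inter_isOpen Metric.isOpen_ball).isOpen_setOf_mem_thickening hg r).mem_nhds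
      (Metric.mem_thickening_iff.2
        ⟨p x, ⟨hp x hx, Metric.mem_ball_self (sub_pos.2 hs)⟩, hgp x hx⟩)
  filter_upwards [hmem] with x' hx' hxF'
  obtain ⟨y, ⟨hyΨ, hyb⟩, hy⟩ := Metric.mem_thickening_iff.1 hx'
  have h1 := (hconv x').dist_le_of_notMem_thickening hr' (hp x' hxF') hyΨ (hgp x' hxF') hy
    (hF x' hxF')
  rw [← dist_eq_norm]
  have h2 := dist_triangle (p x') y (p x)
  have h3 := Metric.mem_ball.1 hyb
  linarith

variable {ι : Type*}

/-- Approximate selections on a closed set for a lower semicontinuous convex-valued mapping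
whose values are uniformly close to an `ℓ¹`-ball. -/
theorem IsCollectionwiseNormal.exists_approx_of_subset_thickening (hX : IsCollectionwiseNormal X)
    (b : HilbertBasis ι ℝ E) (n : ℕ) {C : Set X} (hC : IsClosed C) {Ψ : X → Set E}
    (hΨ : LowerHemicontinuous Ψ) (hconv : ∀ x, Convex ℝ (Ψ x))
    (hball : ∀ x, Ψ x ⊆ Metric.ball 0 1)
    (hthick : ∀ x, Ψ x ⊆ Metric.thickening (1 / 16) (l1Ball b n))
    (hne : ∀ x ∈ C, (Ψ x).Nonempty) :
    ∃ g : X → E, Continuous g ∧ ∀ x ∈ C, g x ∈ Metric.thickening (1 / 2) (Ψ x) := by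
  classical
  have := hX.normalSpace
  -- Chosen so that the approximation error satisfies `4 * (1 / 16) ^ 2 + 16 * θ * n ≤ 1 / 32 < (1 /
  -- 2) ^ 2`.
  set θ : ℝ := 1 / (1024 * (n + 1)) with hθdef
  have hθ : 0 < θ := by positivity
  have hθn : 16 * θ * n ≤ 1 / 64 := by
    have h : θ * (1024 * (n + 1)) = 1 := by rw [hθdef]; field_simp
    nlinarith
  have step : ∀ r r' : ℝ, 1 / 2 ≤ r' → 4 * r ^ 2 - 4 * r' ^ 2 < θ ^ 2 → ∀ g : X → E,
      Continuous g → (∀ x ∈ C, g x ∈ Metric.thickening r (Ψ x)) →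
      ∃ g' : X → E, Continuous g' ∧ ∀ x ∈ C, g' x ∈ Metric.thickening r' (Ψ x) := by
    intro r r' hr' hrr' g hg hgC
    have hnear : ∀ x, ∃ y, x ∈ C → y ∈ Ψ x ∧ dist (g x) y < r := fun x => by
      by_cases hx : x ∈ C
      · obtain ⟨y, hy⟩ := Metric.mem_thickening_iff.1 (hgC x hx)
        exact ⟨y, fun _ => hy⟩
      · exact ⟨0, fun h => absurd h hx⟩
    choose p hp using hnear
    let F : Set X := C ∩ {x | g x ∈ Metric.thickening r' (Ψ x)}ᶜ
    have hFc : IsClosed F := hC.inter (hΨ.isOpen_setOf_mem_thickening hg r').isClosed_compl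
    have hosc : OscLE θ p F := hΨ.oscLE hconv hg hθ (by linarith) hrr' (fun x hx => hx.2)
      (fun x hx => (hp x hx.1).1) fun x hx => (hp x hx.1).2
    obtain ⟨v, hv, hvp⟩ := hX.exists_continuous_approx b hFc hθ hosc
      (fun x hx => (mem_ball_zero_iff.1 (hball x (hp x hx.1).1)).le)
      (fun x hx => hthick x (hp x hx.1).1)
    have hvF : ∀ x ∈ F, v x ∈ Metric.thickening r' (Ψ x) := fun x hx => by
      refine Metric.mem_thickening_iff.2 ⟨p x, (hp x hx.1).1, ?_⟩
      have h1 := hvp x hx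
      rw [← dist_eq_norm] at h1
      refine lt_of_lt_of_le (lt_of_pow_lt_pow_left₀ 2 (by norm_num) ?_) hr'
      nlinarith
    obtain ⟨h, hh, -, hhr⟩ := exists_continuous_glue hconv hg hv
      (hΨ.isOpen_setOf_mem_thickening hv r').isClosed_compl hFc
      (disjoint_left.2 fun x hx hxF => hx (hvF x hxF)) r'
    exact ⟨h, hh, fun x hx => hhr x (fun hxF => by_contra fun h' => hxF ⟨hx, h'⟩)
      fun h' => not_not.1 h'⟩
  -- With radii at most 1, a decrement of at most `θ ^ 2 / 16` changes `4 * r ^ 2` by at most `θ ^ 2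
  -- / 2`, as `step` requires.
  have key : ∀ j : ℕ, ∃ g : X → E, Continuous g ∧
      ∀ x ∈ C, g x ∈ Metric.thickening (max (1 - j * (θ ^ 2 / 16)) (1 / 2)) (Ψ x) := by
    intro j
    induction j with
    | zero =>
      refine ⟨fun _ => 0, continuous_const, fun x hx => ?_⟩
      obtain ⟨y, hy⟩ := hne x hx
      refine Metric.mem_thickening_iff.2 ⟨y, hy, ?_⟩
      have := Metric.mem_ball.1 (hball x hy)
      rw [dist_comm] at this
      exact lt_of_lt_of_le this (by simp)
    | succ j ih =>
      obtain ⟨g, hg, hgC⟩ := ih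
      refine step _ _ (le_max_right _ _) ?_ g hg hgC
      have hθ2 : 0 < θ ^ 2 := by positivity
      push_cast
      have hj : (0 : ℝ) ≤ j * (θ ^ 2 / 16) := by positivity
      have e : 1 - (j + 1 : ℝ) * (θ ^ 2 / 16) = 1 - j * (θ ^ 2 / 16) - θ ^ 2 / 16 := by ring
      rw [e]
      generalize (j : ℝ) * (θ ^ 2 / 16) = t at *
      have h1 : max (1 - t) (1 / 2) ≤ max (1 - t - θ ^ 2 / 16) (1 / 2) + θ ^ 2 / 16 := by
        refine max_le ?_ ?_
        · linarith [le_max_left (1 - t - θ ^ 2 / 16) (1 / 2)]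
        · linarith [le_max_right (1 - t - θ ^ 2 / 16) (1 / 2)]
      have h2 : max (1 - t) (1 / 2) ≤ 1 := max_le (by linarith) (by norm_num)
      have h3 : max (1 - t - θ ^ 2 / 16) (1 / 2) ≤ 1 := max_le (by linarith) (by norm_num)
      have h4 := le_max_right (1 - t) (1 / 2)
      have h5 := le_max_right (1 - t - θ ^ 2 / 16) (1 / 2)
      generalize max (1 - t) (1 / 2) = r at *
      generalize max (1 - t - θ ^ 2 / 16) (1 / 2) = r' at *
      nlinarith
  obtain ⟨j, hj⟩ := exists_nat_ge (1 / (θ ^ 2 / 16))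
  obtain ⟨g, hg, hgC⟩ := key j
  rw [div_le_iff₀ (by positivity)] at hj
  rw [max_eq_right (by linarith)] at hgC
  exact ⟨g, hg, hgC⟩

end Selection

/-! ### Reduction to `ℓ¹`-balls, and iteration -/

section Selection

open Set Filter

variable {X E : Type*} [TopologicalSpace X] [NormedAddCommGroup E] [InnerProductSpace ℝ E]

/-- An increasing sequence of closed sets carrying approximate selections yields a single
approximate selection, continuous at the interior points of these sets. -/
theorem exists_approx_iUnion [NormalSpace X] {Φ : X → Set E} (hΦ : LowerHemicontinuous Φ)
    (hconv : ∀ x, Convex ℝ (Φ x)) {r : ℝ} {Q : ℕ → Set X} (hQ : ∀ n, IsClosed (Q n))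
    (hQm : Monotone Q)
    (hg : ∀ n, ∃ g : X → E, Continuous g ∧ ∀ x ∈ Q n, g x ∈ Metric.thickening r (Φ x)) :
    ∃ h : X → E, (∀ n, ∀ x ∈ interior (Q n), ContinuousAt h x) ∧
      ∀ n, ∀ x ∈ Q n, h x ∈ Metric.thickening r (Φ x) := by
  classical
  let P : ℕ → Type _ := fun n =>
    {h : X → E // Continuous h ∧ ∀ x ∈ Q n, h x ∈ Metric.thickening r (Φ x)}
  -- Successive maps agree on the earlier sets, so the sequence is eventually constant at each point
  -- of the union.
  have step : ∀ n (h : P n), ∃ h' : P (n + 1), EqOn h'.1 h.1 (Q n) := by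
    rintro n ⟨h, hh, hhQ⟩
    obtain ⟨g, hgc, hgQ⟩ := hg (n + 1)
    obtain ⟨k, hk, hkQ, hkr⟩ := exists_continuous_glue hconv hh hgc (hQ n)
      (hΦ.isOpen_setOf_mem_thickening hh r).isClosed_compl
      (disjoint_left.2 fun x hx hx' => hx' (hhQ x hx)) r
    exact ⟨⟨k, hk, fun x hx => hkr x (fun h' => not_not.1 h') fun _ => hgQ x hx⟩, hkQ⟩
  choose next hnext using step
  obtain ⟨g₀, hg₀⟩ := hg 0
  let seq : ∀ n, P n := fun n => Nat.rec ⟨g₀, hg₀⟩ next n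
  have hseq : ∀ m n, m ≤ n → EqOn (seq n).1 (seq m).1 (Q m) := by
    intro m n hmn
    induction n, hmn using Nat.le_induction with
    | base => exact fun x _ => rfl
    | succ n hmn ih => exact fun x hx => (hnext n (seq n) (hQm hmn hx)).trans (ih hx)
  let h : X → E := fun x => if hx : ∃ n, x ∈ Q n then (seq hx.choose).1 x else 0
  have hh : ∀ n, EqOn h (seq n).1 (Q n) := by
    intro n x hx
    have hex : ∃ n, x ∈ Q n := ⟨n, hx⟩
    simp only [h, dif_pos hex]
    rcases le_total hex.choose n with hle | hle
    · exact (hseq _ _ hle hex.choose_spec).symm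
    · exact hseq _ _ hle hx
  refine ⟨h, fun n x hx => ?_, fun n x hx => ?_⟩
  · exact (seq n).2.1.continuousAt.congr
      (eventually_of_mem (mem_interior_iff_mem_nhds.1 hx) fun y hy => (hh n hy).symm)
  · rw [hh n hx]
    exact (seq n).2.2 x hx

/-- A lower semicontinuous mapping to nonempty convex subsets of the open unit ball of a Hilbert
space has an approximate selection within a fixed distance less than `1`. -/
theorem IsCollectionwiseNormal.exists_approx_of_subset_ball [CompleteSpace E]
    (hX : IsCollectionwiseNormal X) {Φ : X → Set E} (hΦ : LowerHemicontinuous Φ)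
    (hconv : ∀ x, Convex ℝ (Φ x)) (hball : ∀ x, Φ x ⊆ Metric.ball 0 1)
    (hne : ∀ x, (Φ x).Nonempty) :
    ∃ g : X → E, Continuous g ∧ ∀ x, g x ∈ Metric.thickening (99999 / 100000) (Φ x) := by
  have := hX.normalSpace
  obtain ⟨w, b, -⟩ := exists_hilbertBasis ℝ E
  let A : ℕ → Set E := fun n => l1Ball b n
  have hAm : Monotone A := fun m n hmn => l1Ball_mono b (Nat.cast_le.2 hmn)
  -- The radius is so close to 1 that `4 * 1 ^ 2 - 4 * (99999 / 100000) ^ 2 < (1 / 48) ^ 2`: on `F`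
  -- any two points of a value are less than `1 / 48` apart.
  let F : Set X := {x | (0 : E) ∈ Metric.thickening (99999 / 100000) (Φ x)}ᶜ
  have hF : IsClosed F := (hΦ.isOpen_setOf_mem_thickening continuous_const _).isClosed_compl
  let C : ℕ → Set X := fun n => F ∩ {x | Φ x ⊆ Metric.cthickening (1 / 24) (A n)}
  have hC : ∀ n, IsClosed (C n) := fun n => hF.inter (by
    have := ((lowerHemicontinuous_iff_isOpen_inter_nonempty.1 hΦ)
      (Metric.cthickening (1 / 24) (A n))ᶜ Metric.isClosed_cthickening.isOpen_compl).isClosed_compl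
    convert this using 1
    ext x
    simp [inter_compl_nonempty_iff])
  let Φ' : ℕ → X → Set E := fun n x => Φ x ∩ Metric.thickening (1 / 16) (A n)
  have hΦ' : ∀ n, LowerHemicontinuous (Φ' n) := fun n => hΦ.inter_isOpen Metric.isOpen_thickening
  have hU : ∀ n, IsOpen {x | (Φ' n x).Nonempty} := fun n =>
    lowerHemicontinuous_iff_isOpen_inter_nonempty.1 hΦ _ Metric.isOpen_thickening
  have hCU : ∀ n, C n ⊆ {x | (Φ' n x).Nonempty} := by
    rintro n x ⟨-, hx⟩
    obtain ⟨y, hy⟩ := hne x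
    exact ⟨y, hy, Metric.cthickening_subset_thickening' (by norm_num) (by norm_num) _ (hx hy)⟩
  have hFC : F ⊆ ⋃ n, C n := by
    intro x hx
    obtain ⟨y, hy⟩ := hne x
    obtain ⟨n, hn⟩ := exists_nat_mem_thickening_l1Ball b y (ε := 1 / 48) (by norm_num)
    refine mem_iUnion.2 ⟨n, hx, fun z hz => ?_⟩
    have hdist : ∀ z ∈ Φ x, dist (0 : E) z < 1 := fun z hz => by
      simpa [dist_comm] using hball x hz
    have h1 := (hconv x).dist_sq_le_of_notMem_thickening (by norm_num) hz hy (hdist z hz)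
      (hdist y hy) hx
    have h2 : dist z y < 1 / 48 := lt_of_pow_lt_pow_left₀ 2 (by norm_num) (by linarith)
    refine Metric.thickening_subset_cthickening _ _ ?_
    have := Metric.thickening_thickening_subset (1 / 48) (1 / 48) (A n)
      (Metric.mem_thickening_iff.2 ⟨y, hn, h2⟩)
    norm_num at this ⊢
    exact this
  choose f hf0 hf1 hf using fun n => exists_continuous_zero_one_of_isClosed
    (hU n).isClosed_compl (hC n) (disjoint_left.2 fun x hx hxC => hx (hCU n hxC))
  -- Increasing closed sets with `C n` in the interior of `Q n`, on which `Φ' n` still has nonempty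
  -- values.
  let Q : ℕ → Set X := fun n => ⋃ m ∈ Iic n, {x | 1 / 2 ≤ f m x}
  have hQ : ∀ n, IsClosed (Q n) := fun n => (finite_Iic n).isClosed_biUnion
    fun m _ => isClosed_le continuous_const (f m).continuous
  have hQm : Monotone Q := fun m n hmn => biUnion_subset_biUnion_left (Iic_subset_Iic.2 hmn)
  have hQU : ∀ n, ∀ x ∈ Q n, (Φ' n x).Nonempty := by
    intro n x hx
    obtain ⟨m, hm, hxm⟩ := mem_iUnion₂.1 hx
    have hmx : (Φ' m x).Nonempty := by
      by_contra h
      have : f m x = 0 := hf0 m h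
      rw [mem_ofPred_eq, this] at hxm
      norm_num at hxm
    exact hmx.mono (inter_subset_inter_right _
      (Metric.thickening_subset_of_subset _ (hAm hm)))
  obtain ⟨h, hhc, hhQ⟩ := exists_approx_iUnion hΦ hconv hQ hQm (r := 1 / 2) (fun n => by
    obtain ⟨g, hg, hgQ⟩ := hX.exists_approx_of_subset_thickening b n (hQ n) (hΦ' n)
      (fun x => (hconv x).inter ((convex_l1Ball b n).thickening _))
      (fun x => inter_subset_left.trans (hball x)) (fun x => inter_subset_right) (hQU n)
    exact ⟨g, hg, fun x hx => Metric.thickening_subset_of_subset _ inter_subset_left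
      (hgQ x hx)⟩)
  let V : Set X := ⋃ n, interior (Q n)
  have hFV : F ⊆ V := by
    intro x hx
    obtain ⟨n, hn⟩ := mem_iUnion.1 (hFC hx)
    refine mem_iUnion.2 ⟨n, mem_interior.2 ⟨{x | 1 / 2 < f n x}, fun y hy => ?_,
      isOpen_lt continuous_const (f n).continuous, ?_⟩⟩
    · exact mem_iUnion₂.2 ⟨n, le_refl n, show 1 / 2 ≤ f n y from le_of_lt hy⟩
    · have : f n x = 1 := hf1 n hn
      rw [mem_ofPred_eq, this]
      norm_num
  obtain ⟨P, hP, hFP, hPV⟩ := normal_exists_closure_subset hF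
    (isOpen_iUnion fun n => isOpen_interior) hFV
  obtain ⟨τ, hτ0, hτ1, hτ⟩ := exists_continuous_zero_one_of_isClosed hP.isClosed_compl hF
    (disjoint_left.2 fun x hx hxF => hx (hFP hxF))
  have hhV : ∀ x ∈ V, h x ∈ Metric.thickening (99999 / 100000) (Φ x) := fun x hx => by
    obtain ⟨n, hn⟩ := mem_iUnion.1 hx
    exact Metric.thickening_mono (by norm_num) _ (hhQ n x (interior_subset hn))
  -- Off `F` the zero map is good enough, and near `F` so is `h`; convexity of the thickened values
  -- handles the transition.
  refine ⟨fun x => τ x • h x, continuous_iff_continuousAt.2 fun x => ?_, fun x => ?_⟩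
  · by_cases hx : x ∈ closure P
    · obtain ⟨n, hn⟩ := mem_iUnion.1 (hPV hx)
      exact τ.continuous.continuousAt.smul (hhc n x hn)
    · refine (continuousAt_const (y := (0 : E))).congr
        (eventually_of_mem (isClosed_closure.isOpen_compl.mem_nhds hx) fun y hy => ?_)
      have : τ y = 0 := hτ0 fun hyP => hy (subset_closure hyP)
      simp [this]
  · by_cases hxF : x ∈ F
    · have : τ x = 1 := hτ1 hxF
      simpa [this] using hhV x (hFV hxF)
    · by_cases hxP : x ∈ P
      · have := ((hconv x).thickening (99999 / 100000)) (hhV x (hPV (subset_closure hxP)))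
          (not_not.1 hxF) (hτ x).1 (sub_nonneg.2 (hτ x).2) (by ring)
        simpa using this
      · have : τ x = 0 := hτ0 hxP
        simpa [this] using not_not.1 hxF

/-- Improving an approximate selection by a constant factor. -/
theorem IsCollectionwiseNormal.exists_improved_approx [CompleteSpace E]
    (hX : IsCollectionwiseNormal X) {Φ : X → Set E} (hΦ : LowerHemicontinuous Φ)
    (hconv : ∀ x, Convex ℝ (Φ x)) {g : X → E} (hg : Continuous g) {r : ℝ} (hr : 0 < r)
    (hgr : ∀ x, g x ∈ Metric.thickening r (Φ x)) :
    ∃ g' : X → E, Continuous g' ∧ (∀ x, g' x ∈ Metric.thickening (99999 / 100000 * r) (Φ x)) ∧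
      ∀ x, dist (g x) (g' x) ≤ 2 * r := by
  -- Translated by `g` and scaled by `1 / r`, the values meet the open unit ball.
  let Ψ : X → Set E := fun x => {z | g x + r • z ∈ Φ x}
  have hΨ : LowerHemicontinuous Ψ := by
    rw [lowerHemicontinuous_iff_isOpen_inter_nonempty]
    intro U hU
    have := hΦ.isOpen_setOf_exists_mem (O := {z : X × E | r⁻¹ • (z.2 - g z.1) ∈ U})
      (hU.preimage (by fun_prop))
    convert this using 1
    ext x
    constructor
    · rintro ⟨z, hz, hzU⟩
      exact ⟨g x + r • z, hz, by simpa [smul_smul, hr.ne'] using hzU⟩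
    · rintro ⟨y, hy, hyU⟩
      exact ⟨r⁻¹ • (y - g x), by simpa [Ψ, smul_smul, hr.ne'] using hy, hyU⟩
  have hΨc : ∀ x, Convex ℝ (Ψ x) := by
    intro x y hy z hz s t hs ht hst
    have := hconv x hy hz hs ht hst
    simp only [Ψ, mem_ofPred_eq] at this ⊢
    convert this using 1
    have e : g x = s • g x + t • g x := by rw [← add_smul, hst, one_smul]
    nth_rewrite 1 [e]
    simp only [smul_add, smul_comm r]
    abel
  obtain ⟨γ, hγ, hγr⟩ := hX.exists_approx_of_subset_ball
    (hΨ.inter_isOpen (Metric.isOpen_ball (x := (0 : E)) (ε := 1)))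
    (fun x => (hΨc x).inter (convex_ball 0 1)) (fun x => inter_subset_right) (fun x => by
      obtain ⟨y, hy, hd⟩ := Metric.mem_thickening_iff.1 (hgr x)
      refine ⟨r⁻¹ • (y - g x), by simpa [Ψ, smul_smul, hr.ne'] using hy, ?_⟩
      rw [mem_ball_zero_iff, norm_smul, ← dist_eq_norm, dist_comm, norm_inv, Real.norm_eq_abs,
        abs_of_pos hr, inv_mul_lt_iff₀ hr]
      simpa using hd)
  refine ⟨fun x => g x + r • γ x, by fun_prop, fun x => ?_, fun x => ?_⟩
  · obtain ⟨z, ⟨hz, -⟩, hd⟩ := Metric.mem_thickening_iff.1 (hγr x)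
    refine Metric.mem_thickening_iff.2 ⟨_, hz, ?_⟩
    rw [dist_add_left, dist_smul₀, Real.norm_eq_abs, abs_of_pos hr, mul_comm]
    exact mul_lt_mul_of_pos_right hd hr
  · obtain ⟨z, ⟨-, hz⟩, hd⟩ := Metric.mem_thickening_iff.1 (hγr x)
    have h1 : ‖γ x‖ ≤ 2 := by
      have h2 := dist_triangle (γ x) z 0
      have h3 := Metric.mem_ball.1 hz
      rw [← dist_zero_right]
      linarith
    rw [dist_eq_norm, sub_add_cancel_left, norm_neg, norm_smul, Real.norm_eq_abs, abs_of_pos hr,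
      mul_comm]
    exact mul_le_mul_of_nonneg_right h1 hr.le

/-- An approximate selection of a lower semicontinuous mapping to closed convex sets can be
turned into a selection. -/
theorem IsCollectionwiseNormal.exists_selection_of_approx [CompleteSpace E]
    (hX : IsCollectionwiseNormal X) {Φ : X → Set E} (hΦ : LowerHemicontinuous Φ)
    (hconv : ∀ x, Convex ℝ (Φ x)) (hcl : ∀ x, IsClosed (Φ x)) {g : X → E} (hg : Continuous g)
    {ε : ℝ} (hε : 0 < ε) (hgε : ∀ x, g x ∈ Metric.thickening ε (Φ x)) :
    ∃ f : X → E, Continuous f ∧ ∀ x, f x ∈ Φ x := by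
  let P : ℕ → Type _ := fun n => {h : X → E // Continuous h ∧
    ∀ x, h x ∈ Metric.thickening ((99999 / 100000) ^ n * ε) (Φ x)}
  have step : ∀ n (h : P n), ∃ h' : P (n + 1),
      ∀ x, dist (h.1 x) (h'.1 x) ≤ 2 * ε * (99999 / 100000) ^ n := by
    rintro n ⟨h, hh, hhn⟩
    obtain ⟨h', hh', hhn', hd⟩ := hX.exists_improved_approx hΦ hconv hh (by positivity) hhn
    refine ⟨⟨h', hh', fun x => ?_⟩, fun x => (hd x).trans_eq (by ring)⟩
    rw [pow_succ', mul_assoc]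
    exact hhn' x
  choose next hnext using step
  let seq : ∀ n, P n := fun n => Nat.rec ⟨g, hg, by simpa using hgε⟩ next n
  have hseq : ∀ x n, dist ((seq n).1 x) ((seq (n + 1)).1 x) ≤ 2 * ε * (99999 / 100000) ^ n :=
    fun x n => hnext n (seq n) x
  choose f hf using fun x => cauchySeq_tendsto_of_complete
    (cauchySeq_of_le_geometric _ _ (by norm_num) (hseq x))
  have h0 : Tendsto (fun n : ℕ => (99999 / 100000 : ℝ) ^ n) atTop (𝓝 0) :=
    tendsto_pow_atTop_nhds_zero_of_lt_one (by norm_num) (by norm_num)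
  refine ⟨f, ?_, fun x => ?_⟩
  · refine TendstoUniformly.continuous (F := fun n => (seq n).1) (p := atTop) ?_
      (Eventually.of_forall fun n => (seq n).2.1).frequently
    rw [Metric.tendstoUniformly_iff]
    intro δ hδ
    have h1 : Tendsto (fun n : ℕ => 2 * ε * (99999 / 100000 : ℝ) ^ n / (1 - 99999 / 100000))
        atTop (𝓝 0) := by
      simpa using (h0.const_mul (2 * ε)).div_const (1 - 99999 / 100000)
    filter_upwards [h1.eventually (gt_mem_nhds hδ)] with n hn x
    rw [dist_comm]
    exact (dist_le_of_le_geometric_of_tendsto _ _ (by norm_num) (hseq x) (hf x) n).trans_lt hn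
  · choose y hy hd using fun n => Metric.mem_thickening_iff.1 ((seq n).2.2 x)
    refine (hcl x).mem_of_tendsto (f := y) (b := atTop) ?_ (Eventually.of_forall hy)
    refine (hf x).congr_dist (squeeze_zero (fun _ => dist_nonneg) (fun n => (hd n).le) ?_)
    simpa using h0.mul_const ε

end Selection

theorem mainTheorem3 {X E : Type*} [TopologicalSpace X] [T2Space X]
    [NormedAddCommGroup E] [InnerProductSpace ℝ E] [CompleteSpace E]
    (hX : IsCollectionwiseNormal X)
    (Φ : X → Set E) (hΦ : ∀ x, Φ x ∈ closedConvexSets E) (hlsc : LowerHemicontinuous Φ)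
    (hε : ∃ ε : ℝ, 0 < ε ∧ ∃ g : X → E, Continuous g ∧ IsEpsSelection ε g Φ) :
    ∃ f : X → E, Continuous f ∧ IsSelection f Φ := by
  obtain ⟨ε, hε, g, hg, hgε⟩ := hε
  exact hX.exists_selection_of_approx hlsc (fun x => (hΦ x).2.2) (fun x => (hΦ x).2.1) hg hε hgε
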